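/- \textbf{Setting.} An MDP consists of a state space $\mathcal X$ and an action space $\mathcal A$ (measurable spaces), a discount factor $\gamma\in[0,1)$ and a model $m^*=(\mathcal R,\mathcal P)$, with a reward kernel $\mathcal R:\mathcal X\times\mathcal A\to\mathscr P(\mathbb R)$ and a transition kernel $\mathcal P:\mathcal X\times\mathcal A\to\mathscr P(\mathcal X)$. A policy is a kernel $\pi:\mathcal X\to\mathscr P(\mathcal A)$. The return distribution $\eta^\pi_{\tilde m}(x)$ of $\pi$ in a model $\tilde m$ is the law of $\sum_{t\ge0}\gamma^tR_t$ along the trajectory from $X_0=x$ (it exists if the series converges almost surely), and $\eta^\pi=\eta^\pi_{m^*}$. The distributional Bellman operator $\mathcal T^\pi$ maps $\eta\in\mathscr P(\mathbb R)^{\mathcal X}$ (measurable in the state) to $\mathcal T^\pi\eta$, where $\mathcal T^\pi\eta(x)$ is the law of $R+\gamma Z$ for $A\sim\pi(\cdot\,|\,x)$, $R\sim\mathcal R(x,A)$, $X'\sim\mathcal P(x,A)$, $Z\sim\eta(X')$. A set $\Omega\subseteq\mathscr P(\mathbb R)$ is closed under $\mathcal T^\pi$ if $\eta\in\Omega^{\mathcal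 X}$ implies $\mathcal T^\pi\eta\in\Omega^{\mathcal X}$. A sketch $\psi=(\psi_1,\dots,\psi_m):\mathscr P_\psi(\mathbb R)\to\mathbb R^m$ is a tuple of real functions $\psi_i$ on sets $\mathscr P_{\psi_i}(\mathbb R)\subseteq\mathscr P(\mathbb R)$, with $\mathscr P_\psi(\mathbb R)=\bigcap_i\mathscr P_{\psi_i}(\mathbb R)$ and image $I_\psi$; it is applied state by state to $\eta\in\mathscr P_\psi(\mathbb R)^{\mathcal X}$. It is \emph{Bellman-closed} if for every MDP and policy $\pi$ such that $\mathscr P_\psi(\mathbb R)$ is closed under $\mathcal T^\pi$ there is an operator $\mathcal T^\pi_\psi:I_\psi^{\mathcal X}\to I_\psi^{\mathcal X}$ with $\psi(\mathcal T^\pi\eta)=\mathcal T^\pi_\psi\psi(\eta)$ for all $\eta\in\mathscr P_\psi(\mathbb R)^{\mathcal X}$. The $m$-moment sketch is $\psi^m_\mu=(\mu_1,\dots,\mu_m)$, with $\mu_i(\nu)=\mathbb E_{Z\sim\nu}[Z^i]$, on the set $\mathscr P_m(\mathbb R)$ of measures with finite $m$th moment. For a set $\mathcal M$ of models, $\mathcal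 M^\infty_\psi$ is the set of proper $\psi$-equivalent models: those $\tilde m\in\mathcal M$ such that, for all policies $\pi$ and all $x\in\mathcal X$, $\eta^\pi_{\tilde m}(x)$ and $\eta^\pi(x)$ exist, lie in $\mathscr P_\psi(\mathbb R)$ and satisfy $\psi(\eta^\pi_{\tilde m}(x))=\psi(\eta^\pi(x))$. A risk measure is a function $\rho:\mathscr P_\rho(\mathbb R)\to[-\infty,\infty)$ with $\mathscr P_\rho(\mathbb R)\subseteq\mathscr P(\mathbb R)$. A policy $\pi^*$ is optimal for $\rho$ in a model if, in that model, $\rho$ of the return distribution of $\pi^*$ from $x$ is the maximum over all policies, for every $x\in\mathcal X$. We say that $\rho$ \emph{can be planned for exactly with proper $\psi$-equivalent models} in a given MDP and for a given $\mathcal M$ if, for each $\tilde m\in\mathcal M^\infty_\psi$ such that all return distributions of $m^*$ and of $\tilde m$ lie in $\mathscr P_\rho(\mathbb R)$, every policy that is optimal for $\rho$ in $\tilde m$ is optimal for $\rho$ in $m^*$; and simply that it can be planned for exactly if this holds in all MDPs and for all $\mathcal M$. \textbf{Proposition.} Let $\psi=(\psi_1,\dots,\psi_m)$ be a Bellman-closed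 sketch with non-empty domain, and suppose that there are Borel functions $f_i:\mathbb R\to\mathbb R$, $i=1,\dots,m$, such that for every $\nu\in\mathscr P_\psi(\mathbb R)$ the expectation $\mathbb E_{Z\sim\nu}[f_i(Z)]$ is finite and $\psi_i(\nu)=\mathbb E_{Z\sim\nu}[f_i(Z)]$. Suppose that $\mathscr P_\psi(\mathbb R)$ is closed under $\mathcal T^\pi$ for every policy $\pi$ in every MDP with finitely many states and actions and deterministic rewards. Let $\rho$ be a risk measure, and suppose that $\mathscr P_\psi(\mathbb R)$ contains every $\nu\in\mathscr P_\rho(\mathbb R)\cap\mathscr P_m(\mathbb R)$ for which $\mathbb E_{Z\sim\nu}[f_i(Z)]$ is finite for all $i$ (this holds, for instance, if $\mathscr P_\psi(\mathbb R)$ is the set of all $\nu$ for which these expectations are finite). If $\rho$ can be planned for exactly with proper $\psi$-equivalent models, then $\rho$ can be planned for exactly with proper $\psi^m_\mu$-equivalent models. The same implication also holds separately in each single MDP and for each single set $\mathcal M$ of models. -/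

import Mathlib

open MeasureTheory ProbabilityTheory Filter Topology

universe u

namespace RiskRL

noncomputable section

/-! ### Markov decision processes

The state space `X` and the action space `A` are measurable spaces. When they are finite or
countable with the discrete σ-algebra, Markov kernels are the same as arbitrary families of
probability measures. -/

/-- A model: a transition kernel and a reward kernel. Together with a discount factor it is an
MDP with state space `X` and action space `A`. -/
structure Model (X A : Type*) [MeasurableSpace X] [MeasurableSpace A] where
  transition : Kernel (X × A) X
  reward : Kernel (X × A) ℝ
  [markov_transition : IsMarkovKernel transition]
  [markov_reward : IsMarkovKernel reward]

attribute [instance] Model.markov_transition Model.markov_reward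

/-- A (stationary Markov) policy. -/
structure Policy (X A : Type*) [MeasurableSpace X] [MeasurableSpace A] where
  act : Kernel X A
  [markov_act : IsMarkovKernel act]

attribute [instance] Policy.markov_act

/-- A return-distribution function: a probability measure on `ℝ` for each state. -/
structure ReturnFunction (X : Type*) [MeasurableSpace X] where
  dist : Kernel X ℝ
  [markov_dist : IsMarkovKernel dist]

attribute [instance] ReturnFunction.markov_dist

/-- Discount factors `γ ∈ [0, 1)`. -/
abbrev Discount : Type := Set.Ico (0 : ℝ) 1

section MDP

variable {X A : Type*} [MeasurableSpace X] [MeasurableSpace A]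

/-- The value of a return-distribution function at a state. -/
def ReturnFunction.at (η : ReturnFunction X) (x : X) : ProbabilityMeasure ℝ :=
  ⟨η.dist x, inferInstance⟩

namespace Model

/-- Given the current state `x`, the law of `(x, a, r)` with `a ∼ π(x)`, `r ∼ R(x, a)`. -/
def sample (M : Model X A) (π : Policy X A) : Kernel X (X × A × ℝ) :=
  Kernel.id ×ₖ (π.act ⊗ₖ M.reward)

instance (M : Model X A) (π : Policy X A) : IsMarkovKernel (M.sample π) := by
  unfold sample; infer_instance

/-- Given `(X_t, A_t, R_t)`, the law of `(X_{t+1}, A_{t+1}, R_{t+1})`: draw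
`X_{t+1} ∼ P(X_t, A_t)`, then the action and the reward at `X_{t+1}`. -/
def next (M : Model X A) (π : Policy X A) : Kernel (X × A × ℝ) (X × A × ℝ) :=
  M.sample π ∘ₖ M.transition.comap (fun y => (y.1, y.2.1)) (by fun_prop)

instance (M : Model X A) (π : Policy X A) : IsMarkovKernel (M.next π) := by
  unfold next; infer_instance

/-- The law of the trajectory `(X_t, A_t, R_t)_{t ≥ 0}` of the policy `π` from `X_0 = x`. -/
def trajectory (M : Model X A) (π : Policy X A) (x : X) : Measure (ℕ → X × A × ℝ) :=
  Kernel.trajMeasure (X := fun _ => X × A × ℝ) (M.sample π x)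
    (fun n => (M.next π).comap (fun h => h ⟨n, Finset.mem_Iic.2 le_rfl⟩) (by fun_prop))

instance (M : Model X A) (π : Policy X A) (x : X) :
    IsProbabilityMeasure (M.trajectory π x) := by
  unfold trajectory; infer_instance

end Model

/-- The truncated discounted return `∑_{t < n} γ ^ t R_t` of a trajectory. -/
def partialReturn (γ : Discount) (ω : ℕ → X × A × ℝ) (n : ℕ) : ℝ :=
  ∑ t ∈ Finset.range n, (γ : ℝ) ^ t * (ω t).2.2

/-- The return `∑_{t ≥ 0} γ ^ t R_t` of a trajectory, the limit of the truncated returns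
(an arbitrary real number if there is no limit, see `Model.HasReturn`). -/
def totalReturn (γ : Discount) (ω : ℕ → X × A × ℝ) : ℝ :=
  limUnder atTop (partialReturn γ ω)

lemma measurable_partialReturn (γ : Discount) (n : ℕ) :
    Measurable (fun ω : ℕ → X × A × ℝ => partialReturn γ ω n) := by
  unfold partialReturn
  fun_prop

lemma measurable_totalReturn (γ : Discount) :
    Measurable (totalReturn γ : (ℕ → X × A × ℝ) → ℝ) :=
  (StronglyMeasurable.limUnder
    (fun n => (measurable_partialReturn (X := X) (A := A) γ n).stronglyMeasurable)).measurable

namespace Model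

/-- The return of `π` from `x` is well defined: the series `∑ γ ^ t R_t` converges a.s. -/
def HasReturn (M : Model X A) (γ : Discount) (π : Policy X A) (x : X) : Prop :=
  ∀ᵐ ω ∂(M.trajectory π x), ∃ g : ℝ, Tendsto (partialReturn γ ω) atTop (𝓝 g)

/-- The return distribution `η^π(x)`: the law of the return of `π` from `x`. -/
def returnLaw (M : Model X A) (γ : Discount) (π : Policy X A) (x : X) : ProbabilityMeasure ℝ :=
  ⟨(M.trajectory π x).map (totalReturn γ),
    Measure.isProbabilityMeasure_map (measurable_totalReturn γ).aemeasurable⟩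

/-- All the return distributions of the MDP exist and lie in the set `D`. -/
def ReturnsIn (M : Model X A) (γ : Discount) (D : Set (ProbabilityMeasure ℝ)) : Prop :=
  ∀ π x, M.HasReturn γ π x ∧ M.returnLaw γ π x ∈ D

/-- The distributional Bellman operator: `(T^π η)(x)` is the law of `R + γ Z`, where
`a ∼ π(x)`, `R ∼ R(x, a)`, `x' ∼ P(x, a)` and `Z ∼ η(x')`, with `R` and `(x', Z)` independent
given `a`. -/
def bellman (M : Model X A) (γ : Discount) (π : Policy X A) (η : ReturnFunction X) :
    ReturnFunction X where
  dist := (π.act ⊗ₖ (M.reward ×ₖ (η.dist ∘ₖ M.transition))).map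
    (fun q => q.2.1 + (γ : ℝ) * q.2.2)
  markov_dist := Kernel.IsMarkovKernel.map _ (by fun_prop)

/-- The set `D` of probability measures is closed under the operator `T^π`. -/
def ClosedUnder (M : Model X A) (γ : Discount) (π : Policy X A)
    (D : Set (ProbabilityMeasure ℝ)) : Prop :=
  ∀ η : ReturnFunction X, (∀ x, η.at x ∈ D) → ∀ x, (M.bellman γ π η).at x ∈ D

/-- The rewards are deterministic. -/
def DeterministicReward (M : Model X A) : Prop :=
  ∃ r : X × A → ℝ, ∀ p, M.reward p = Measure.dirac (r p)

end Model

end MDP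

/-! ### Sketches -/

/-- A statistical functional: a real function on a set of probability measures on `ℝ`. -/
structure StatFunctional where
  domain : Set (ProbabilityMeasure ℝ)
  val : domain → ℝ

/-- A sketch: a tuple of statistical functionals. -/
abbrev Sketch (m : ℕ) : Type := Fin m → StatFunctional

namespace Sketch

variable {m : ℕ}

/-- The domain of a sketch: the intersection of the domains of its components. -/
def domain (ψ : Sketch m) : Set (ProbabilityMeasure ℝ) := ⋂ i, (ψ i).domain

/-- The value of a sketch. -/
def val (ψ : Sketch m) (ν : ψ.domain) : Fin m → ℝ :=
  fun i => (ψ i).val ⟨ν.1, Set.mem_iInter.1 ν.2 i⟩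

/-- The image `I_ψ` of a sketch. -/
def image (ψ : Sketch m) : Set (Fin m → ℝ) := Set.range ψ.val

/-- The sketch applied state by state, to a return-distribution function with values in its
domain. -/
def statistic {X : Type*} [MeasurableSpace X] (ψ : Sketch m) (η : ReturnFunction X)
    (h : ∀ x, η.at x ∈ ψ.domain) : X → ψ.image :=
  fun x => ⟨ψ.val ⟨η.at x, h x⟩, Set.mem_range_self _⟩

/-- A sketch is Bellman-closed if, for every MDP and policy under whose distributional Bellman
operator its domain is closed, there is an operator on statistics that intertwines. -/
def BellmanClosed (ψ : Sketch m) : Prop :=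
  ∀ (X A : Type u) [MeasurableSpace X] [MeasurableSpace A] (M : Model X A) (γ : Discount)
    (π : Policy X A) (hD : M.ClosedUnder γ π ψ.domain),
    ∃ T : (X → ψ.image) → (X → ψ.image),
      ∀ (η : ReturnFunction X) (h : ∀ x, η.at x ∈ ψ.domain),
        ψ.statistic (M.bellman γ π η) (hD η h) = T (ψ.statistic η h)

/-- The domain of the sketch is closed under the distributional Bellman operators of all finite
MDPs with deterministic rewards. -/
def DomainClosed (ψ : Sketch m) : Prop :=
  ∀ (X A : Type u) [Finite X] [Finite A] [MeasurableSpace X] [MeasurableSpace A]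
    [DiscreteMeasurableSpace X] [DiscreteMeasurableSpace A] (M : Model X A) (γ : Discount)
    (π : Policy X A), M.DeterministicReward → M.ClosedUnder γ π ψ.domain

/-- The set of proper `ψ`-equivalent models among the models in `S`, for the true model `M` and
with respect to all policies: those with the same return statistics `ψ(η^π(x))` as `M`. -/
def properEquivalent {X A : Type*} [MeasurableSpace X] [MeasurableSpace A] (ψ : Sketch m)
    (γ : Discount) (M : Model X A) (S : Set (Model X A)) : Set (Model X A) :=
  {M' | M' ∈ S ∧ ∃ (h : M.ReturnsIn γ ψ.domain) (h' : M'.ReturnsIn γ ψ.domain),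
    ∀ π x, ψ.val ⟨M'.returnLaw γ π x, (h' π x).2⟩ = ψ.val ⟨M.returnLaw γ π x, (h π x).2⟩}

end Sketch

/-- The `m`-moment sketch `(μ_1, …, μ_m)`; component `i : Fin m` is the moment of order
`i + 1`, defined on the measures for which this moment is finite. -/
def momentSketch (m : ℕ) : Sketch m := fun i =>
  { domain := {ν | Integrable (fun z : ℝ => z ^ ((i : ℕ) + 1)) (ν : Measure ℝ)}
    val := fun ν => ∫ z, z ^ ((i : ℕ) + 1) ∂(ν.1 : Measure ℝ) }

/-! ### Risk measures and planning -/

/-- A risk measure: a function with values in `[-∞, ∞)` on a set of probability measures. -/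
structure RiskMeasure where
  domain : Set (ProbabilityMeasure ℝ)
  val : domain → WithBot ℝ

namespace RiskMeasure

section

variable {X A : Type*} [MeasurableSpace X] [MeasurableSpace A]

/-- The policy `π` is optimal with respect to `ρ` in the MDP given by `M` and `γ`, in which `ρ`
is defined at all the return distributions. -/
def IsOptimal (ρ : RiskMeasure) (γ : Discount) (M : Model X A) (h : M.ReturnsIn γ ρ.domain)
    (π : Policy X A) : Prop :=
  ∀ x, ∀ π', ρ.val ⟨M.returnLaw γ π' x, (h π' x).2⟩ ≤ ρ.val ⟨M.returnLaw γ π x, (h π x).2⟩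

/-- In the MDP given by the true model `M` and `γ`, with `S` as the set of models under
consideration, proper `ψ`-equivalent models suffice to plan exactly for `ρ`: a policy optimal
for `ρ` in such a model is optimal for `ρ` in the true MDP (whenever `ρ` is defined at the
return distributions of both). -/
def PlansExactlyIn {m : ℕ} (ρ : RiskMeasure) (ψ : Sketch m) (γ : Discount) (M : Model X A)
    (S : Set (Model X A)) : Prop :=
  ∀ M' ∈ ψ.properEquivalent γ M S,
    ∀ (h : M.ReturnsIn γ ρ.domain) (h' : M'.ReturnsIn γ ρ.domain) (π : Policy X A),
      ρ.IsOptimal γ M' h' π → ρ.IsOptimal γ M h π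

end

/-- The risk measure `ρ` can be planned for exactly using proper `ψ`-equivalent models: this
holds in every MDP and for every set of models. -/
def PlansExactly {m : ℕ} (ρ : RiskMeasure) (ψ : Sketch m) : Prop :=
  ∀ (X A : Type u) [MeasurableSpace X] [MeasurableSpace A] (γ : Discount) (M : Model X A)
    (S : Set (Model X A)), ρ.PlansExactlyIn ψ γ M S

end RiskMeasure

end

end RiskRL

open RiskRL

namespace RiskRL

/-! ### Finite-dimensional affine-invariant spaces of measurable functions -/

/-! The point is that Bellman-closedness forces every `f i` to be a polynomial of degree at most
`m`; equal first `m` moments then give equal `ψ`.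

Let `V` be the span of the constant 1 and the `f i`, of dimension at most `m + 1`. One-state MDPs
with a constant reward show that, if two laws have the same statistics, so do their images under `z
↦ r + γ z`. On finitely supported laws this says that a signed combination of point masses
annihilating `V` also annihilates `f i (r + γ ·)`. By duality this function lies in `V`
(`comp_affine_mem_span`). So `V` is stable under contractions, and by finite dimension under all
positive affine changes of variable.

Dilations conjugate the translation by `h` on `V` to the translation by `c * h`, so the
characteristic polynomial does not change as `h` is scaled to 0. Measurability yields continuity at
0 by a Steinhaus argument, so this polynomial is that of the identity (`charpoly_translate`). By
Cayley–Hamilton the iterated differences of order `dim V` vanish on `V`. Elements of `V` are also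
continuous, hence polynomials of degree less than `dim V`.

Finally, a moment-equivalent model whose returns, like those of the true model, lie in the domain of
`ρ` is `ψ`-equivalent: the polynomials are integrable, so the domain hypothesis on `ρ` applies. -/

/-- A function on the reals which factors, on differences, continuously through a measurable map
is continuous at zero (Steinhaus). -/
lemma continuousAt_zero_of_measurable_factor {P M : Type*} [TopologicalSpace P]
    [SecondCountableTopology P] [MeasurableSpace P] [OpensMeasurableSpace P] [TopologicalSpace M]
    {G : ℝ → P} (hG : Measurable G) {D : P × P → M} (hD : Continuous D) {F : ℝ → M}
    (hF : ∀ a b, D (G a, G b) = F (a - b)) : ContinuousAt F 0 := by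
  intro W hW
  have key : ∀ x : ℝ, ∃ U : Set P, IsOpen U ∧ G x ∈ U ∧ U ×ˢ U ⊆ D ⁻¹' W := by
    intro x
    have h1 : D ⁻¹' W ∈ 𝓝 (G x, G x) := by
      refine hD.continuousAt.preimage_mem_nhds ?_
      rwa [hF, sub_self]
    rw [nhds_prod_eq, mem_prod_same_iff] at h1
    obtain ⟨t, ht, hsub⟩ := h1
    obtain ⟨U, hUt, hU, hx⟩ := mem_nhds_iff.1 ht
    exact ⟨U, hU, hx, (Set.prod_mono hUt hUt).trans hsub⟩
  choose U hUo hUx hUW using key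
  -- Lindelöf: countably many preimages cover the line, so one has positive Lebesgue measure, and
  -- its difference set is a neighbourhood of 0.
  obtain ⟨T, hT, hTU⟩ := TopologicalSpace.isOpen_iUnion_countable U hUo
  obtain ⟨x, hx⟩ : ∃ x, 0 < volume (G ⁻¹' U x) := by
    by_contra! hcon
    have h0 : volume (⋃ x ∈ T, G ⁻¹' U x) = 0 :=
      (measure_biUnion_null_iff hT).2 fun x _ => nonpos_iff_eq_zero.1 (hcon x)
    have huniv : (⋃ x ∈ T, G ⁻¹' U x) = Set.univ := by
      rw [← Set.preimage_iUnion₂, hTU]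
      exact Set.eq_univ_of_forall fun x => Set.mem_iUnion.2 ⟨x, hUx x⟩
    rw [huniv] at h0
    simp at h0
  refine mem_map.2 ?_
  filter_upwards [Measure.sub_mem_nhds_zero_of_addHaar_pos volume (G ⁻¹' U x)
    (hG (hUo x).measurableSet) hx] with h hh
  obtain ⟨a, ha, b, hb, rfl⟩ := Set.mem_sub.1 hh
  have : (G a, G b) ∈ D ⁻¹' W := hUW x ⟨ha, hb⟩
  simpa [hF] using this

/-! ### Vanishing iterated differences and Newton interpolation -/

section Newton

open Finset Polynomial

/-- A function with vanishing `d`-th differences of step `h` is a polynomial of degree less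
than `d` along each arithmetic progression of step `h`. -/
lemma exists_polynomial_eq_on_progression {f : ℝ → ℝ} {d : ℕ} {h : ℝ}
    (hf : (fwdDiff h)^[d] f = 0) (y : ℝ) :
    ∃ Q ∈ degreeLT ℝ d, ∀ n : ℕ, f (y + n * h) = Q.eval (n : ℝ) := by
  have hz : ∀ k, d ≤ k → (fwdDiff h)^[k] f = 0 := by
    intro k hk
    obtain ⟨j, rfl⟩ := Nat.exists_eq_add_of_le' hk
    rw [Function.iterate_add_apply, hf]
    clear hk
    induction j with
    | zero => rfl
    | succ j ih => rw [Function.iterate_succ_apply', ih]; ext; simp [fwdDiff]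
  -- Newton's forward difference series, cut at `d`. The exact expansion at `n` stops at `k = n`;
  -- both sums extend to a common range, since binomials vanish for `k > n` and differences for `k ≥
  -- d`.
  refine ⟨∑ k ∈ range d, C ((fwdDiff h)^[k] f y / (k.factorial : ℝ)) * descPochhammer ℝ k,
    Submodule.sum_mem _ fun k hk => ?_, fun n => ?_⟩
  · rw [mem_degreeLT]
    refine lt_of_le_of_lt (degree_le_natDegree.trans ?_) (Nat.cast_lt.2 (mem_range.1 hk))
    exact Nat.cast_le.2 ((natDegree_C_mul_le _ _).trans (descPochhammer_natDegree ℝ k).le)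
  · have h1 := shift_eq_sum_fwdDiff_iter h f n y
    rw [nsmul_eq_mul] at h1
    have h2 : ∀ k, n.choose k • (fwdDiff h)^[k] f y
        = (C ((fwdDiff h)^[k] f y / (k.factorial : ℝ)) * descPochhammer ℝ k).eval (n : ℝ) := by
      intro k
      rw [nsmul_eq_mul, Nat.cast_choose_eq_descPochhammer_div ℝ, eval_mul, eval_C]
      ring
    rw [h1, eval_finsetSum, sum_congr rfl fun k _ => h2 k]
    have h3 : ∀ N, n + 1 ≤ N → d ≤ N →
        ∑ k ∈ range N, (C ((fwdDiff h)^[k] f y / (k.factorial : ℝ)) *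
          descPochhammer ℝ k).eval (n : ℝ) =
        ∑ k ∈ range (n + 1), (C ((fwdDiff h)^[k] f y / (k.factorial : ℝ)) *
          descPochhammer ℝ k).eval (n : ℝ) := by
      intro N hN _
      refine (sum_subset (range_subset_range.2 hN) fun k _ hk => ?_).symm
      rw [← h2, Nat.choose_eq_zero_of_lt (by simpa using hk), zero_smul]
    rw [← h3 (max (n + 1) d) (le_max_left _ _) (le_max_right _ _)]
    refine (sum_subset (range_subset_range.2 (le_max_right _ _)) fun k _ hk => ?_).symm
    rw [← h2, hz k (by simpa using hk), Pi.zero_apply, smul_zero]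

/-- A continuous function all of whose `d`-th differences vanish is a polynomial of degree less
than `d`. -/
lemma exists_polynomial_of_fwdDiff_iterate_eq_zero {f : ℝ → ℝ} (hc : Continuous f) {d : ℕ}
    (hf : ∀ h, (fwdDiff h)^[d] f = 0) : ∃ P ∈ degreeLT ℝ d, f = fun x => P.eval x := by
  obtain ⟨P, hPd, hP⟩ := exists_polynomial_eq_on_progression (hf 1) 0
  refine ⟨P, hPd, Rat.denseRange_cast.equalizer hc P.continuous ?_⟩
  ext q
  -- This progression starts at an integer below `q`, passes through `q`, and contains every natural
  -- number. Agreement with `P` at the naturals therefore identifies `Q` with `P` reparametrised.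
  obtain ⟨Q, -, hQ⟩ := exists_polynomial_eq_on_progression (hf (1 / q.den)) (-(q.num.natAbs : ℝ))
  have hden : (q.den : ℝ) ≠ 0 := Nat.cast_ne_zero.2 q.den_nz
  have hPQ : P.comp (C (-(q.num.natAbs : ℝ)) + X * C (1 / (q.den : ℝ))) = Q := by
    refine eq_of_infinite_eval_eq _ _ ?_
    refine (Set.infinite_range_of_injective (f := fun k : ℕ =>
      (((q.num.natAbs + k) * q.den : ℕ) : ℝ)) fun a b hab => ?_).mono ?_
    · have := Nat.cast_injective hab
      exact Nat.add_left_cancel (Nat.eq_of_mul_eq_mul_right q.pos this)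
    · rintro _ ⟨k, rfl⟩
      have e : -(q.num.natAbs : ℝ) + (((q.num.natAbs + k) * q.den : ℕ) : ℝ) * (1 / (q.den : ℝ))
          = 0 + (k : ℝ) * 1 := by
        push_cast; field_simp; ring
      have h1 := hP k
      have h2 := hQ ((q.num.natAbs + k) * q.den)
      rw [e, h1] at h2
      simp only [Set.mem_ofPred_eq, eval_comp, eval_add, eval_mul, eval_C, eval_X]
      rw [← h2, e]
      simp
  obtain ⟨n, hn⟩ : ∃ n : ℕ, (n : ℤ) = q.num + q.num.natAbs * q.den := by
    refine ⟨(q.num + q.num.natAbs * q.den).toNat, Int.toNat_of_nonneg ?_⟩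
    have h1 : (1 : ℤ) ≤ q.den := by exact_mod_cast q.pos
    have h2 : -(q.num.natAbs : ℤ) ≤ q.num := by omega
    nlinarith [Int.natCast_nonneg q.num.natAbs]
  have hn' : (n : ℝ) = q.num + (q.num.natAbs : ℝ) * q.den := by
    have := congrArg (Int.cast : ℤ → ℝ) hn
    simpa only [Int.cast_natCast, Int.cast_add, Int.cast_mul] using this
  have e : -(q.num.natAbs : ℝ) + (n : ℝ) * (1 / (q.den : ℝ)) = (q : ℝ) := by
    rw [hn', Rat.cast_def]; field_simp; ring
  have := hQ n
  rw [e, ← hPQ] at this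
  simp only [eval_comp, eval_add, eval_mul, eval_C, eval_X, e] at this
  simpa using this

end Newton

/-! ### Affine-invariant spaces: translations are unipotent -/

section Invariant

open scoped Matrix

variable {V : Submodule ℝ (ℝ → ℝ)}

/-- Precomposition with `x ↦ c * x + h` on a space of functions stable under positive affine
changes of variable. -/
def affineComp (hV : ∀ c > 0, ∀ h : ℝ, ∀ v ∈ V, (fun x => v (c * x + h)) ∈ V)
    (c : ℝ) (hc : 0 < c) (h : ℝ) : V →ₗ[ℝ] V :=
  (LinearMap.funLeft ℝ ℝ (fun x => c * x + h)).restrict (hV c hc h)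

variable (hV : ∀ c > 0, ∀ h : ℝ, ∀ v ∈ V, (fun x => v (c * x + h)) ∈ V)

@[simp]
lemma affineComp_apply (c : ℝ) (hc : 0 < c) (h : ℝ) (v : V) (x : ℝ) :
    (affineComp hV c hc h v : ℝ → ℝ) x = (v : ℝ → ℝ) (c * x + h) := rfl

/-- Evaluation at a point as a linear functional on a space of functions. -/
def evalFunctional (V : Submodule ℝ (ℝ → ℝ)) (x : ℝ) : V →ₗ[ℝ] ℝ :=
  (LinearMap.proj x).comp V.subtype

@[simp]
lemma evalFunctional_apply (x : ℝ) (v : V) : evalFunctional V x v = (v : ℝ → ℝ) x := rfl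

/-- Evaluations separate the elements of `V`, so their common kernel is zero. -/
lemma span_evalFunctional [FiniteDimensional ℝ V] :
    Submodule.span ℝ (Set.range (evalFunctional V)) = ⊤ := by
  refine eq_top_iff.2 fun φ _ => FiniteDimensional.mem_span_of_iInf_ker_le_ker fun v hv => ?_
  have : v = 0 := by
    ext x
    simpa using (Submodule.mem_iInf _).1 hv x
  simp [this]

lemma measurable_functional_translate [FiniteDimensional ℝ V] (hm : ∀ v ∈ V, Measurable v)
    (φ : V →ₗ[ℝ] ℝ) (v : V) : Measurable fun h => φ (affineComp hV 1 one_pos h v) := by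
  have hφ : φ ∈ Submodule.span ℝ (Set.range (evalFunctional V)) := by
    rw [span_evalFunctional]; trivial
  induction hφ using Submodule.span_induction with
  | mem φ h =>
    obtain ⟨x, rfl⟩ := h
    have := hm v v.2
    simp only [evalFunctional_apply, affineComp_apply]
    fun_prop
  | zero => simp
  | add φ ψ _ _ h1 h2 => exact h1.add h2
  | smul a φ _ h => exact h.const_mul a

lemma translate_mul (a b : ℝ) :
    affineComp hV 1 one_pos a ∘ₗ affineComp hV 1 one_pos b = affineComp hV 1 one_pos (a + b) := by
  ext v x
  simp only [LinearMap.comp_apply, affineComp_apply]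
  ring_nf

/-- Translations form a one-parameter group: the matrix at `a - b` is the product of those at `a`
and `-b`. It is thus a continuous function of the measurable pairs (matrix at `h`, matrix at `-h`)
taken at `a` and `b`, as the Steinhaus lemma requires. -/
lemma continuousAt_toMatrix_translate [FiniteDimensional ℝ V] (hm : ∀ v ∈ V, Measurable v)
    {ι : Type*} [Fintype ι] [DecidableEq ι] (b : Module.Basis ι ℝ V) :
    ContinuousAt (fun h => LinearMap.toMatrix b b (affineComp hV 1 one_pos h)) 0 := by
  have hmeas : ∀ i j, Measurable fun h => LinearMap.toMatrix b b (affineComp hV 1 one_pos h) i j :=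
    fun i j => by
      simpa [LinearMap.toMatrix_apply] using measurable_functional_translate hV hm (b.coord i) (b j)
  refine continuousAt_zero_of_measurable_factor (P := (ι → ι → ℝ) × (ι → ι → ℝ))
    (G := fun h => (fun i j => LinearMap.toMatrix b b (affineComp hV 1 one_pos h) i j,
      fun i j => LinearMap.toMatrix b b (affineComp hV 1 one_pos (-h)) i j))
    (D := fun p => (Matrix.of p.1.1 * Matrix.of p.2.2 : Matrix ι ι ℝ)) ?_ ?_ ?_
  · refine Measurable.prodMk ?_ ?_
    · exact measurable_pi_lambda _ fun i => measurable_pi_lambda _ fun j => hmeas i j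
    · exact measurable_pi_lambda _ fun i => measurable_pi_lambda _ fun j =>
        (hmeas i j).comp measurable_neg
  · have h1 : Continuous fun p : ((ι → ι → ℝ) × (ι → ι → ℝ)) × ((ι → ι → ℝ) × (ι → ι → ℝ)) =>
        (Matrix.of p.1.1 : Matrix ι ι ℝ) := continuous_fst.comp continuous_fst
    have h2 : Continuous fun p : ((ι → ι → ℝ) × (ι → ι → ℝ)) × ((ι → ι → ℝ) × (ι → ι → ℝ)) =>
        (Matrix.of p.2.2 : Matrix ι ι ℝ) := continuous_snd.comp continuous_snd
    exact h1.matrix_mul h2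
  · intro x y
    rw [sub_eq_add_neg, ← translate_mul hV, LinearMap.toMatrix_comp b b b]
    rfl

lemma charpoly_translate_smul [FiniteDimensional ℝ V] (c : ℝ) (hc : 0 < c) (h : ℝ) :
    (affineComp hV 1 one_pos (c * h)).charpoly = (affineComp hV 1 one_pos h).charpoly := by
  -- Conjugation by this dilation turns the translation by `h` into the one by `c * h`.
  let e : V ≃ₗ[ℝ] V := LinearEquiv.ofLinearMap (affineComp hV c⁻¹ (inv_pos.2 hc) 0)
    (affineComp hV c hc 0) (by ext v x; simp [hc.ne']) (by ext v x; simp [hc.ne'])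
  rw [← LinearEquiv.charpoly_conj e (affineComp hV 1 one_pos h)]
  congr 1
  ext v x
  simp [e, LinearEquiv.conj_apply, mul_add, hc.ne']

lemma charpoly_translate [FiniteDimensional ℝ V] (hm : ∀ v ∈ V, Measurable v) (h : ℝ) :
    (affineComp hV 1 one_pos h).charpoly = (Polynomial.X - 1) ^ Module.finrank ℝ V := by
  classical
  let b := Module.finBasis ℝ V
  have hid : affineComp hV 1 one_pos 0 = LinearMap.id := by ext v x; simp
  refine Polynomial.funext fun t => ?_
  have hcont : ContinuousAt
      (fun h => (Matrix.scalar _ t - LinearMap.toMatrix b b (affineComp hV 1 one_pos h)).det) 0 :=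
    (continuous_id.matrix_det.continuousAt).comp
      (continuousAt_const.sub (continuousAt_toMatrix_translate hV hm b))
  have heval : ∀ k : ℝ, (affineComp hV 1 one_pos k).charpoly.eval t
      = (Matrix.scalar _ t - LinearMap.toMatrix b b (affineComp hV 1 one_pos k)).det := by
    intro k
    rw [← LinearMap.charpoly_toMatrix _ b, Matrix.eval_charpoly]
  -- The characteristic polynomial is constant along `h / (n + 1)`, so it equals its limit at 0.
  have h0 : Tendsto (fun n : ℕ => (1 / ((n : ℝ) + 1)) * h) atTop (𝓝 0) := by
    simpa using tendsto_one_div_add_atTop_nhds_zero_nat.mul_const h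
  have hlim := hcont.tendsto.comp h0
  have hconst : ∀ n : ℕ, ((fun h => (Matrix.scalar _ t -
      LinearMap.toMatrix b b (affineComp hV 1 one_pos h)).det) ∘
      fun n : ℕ => (1 / ((n : ℝ) + 1)) * h) n = (affineComp hV 1 one_pos h).charpoly.eval t := by
    intro n
    simp only [Function.comp_apply]
    rw [← heval, charpoly_translate_smul hV _ (by positivity)]
  have := tendsto_nhds_unique (tendsto_const_nhds.congr fun n => (hconst n).symm) hlim
  rw [this, hid, LinearMap.toMatrix_id]
  have e : (Matrix.scalar (Fin (Module.finrank ℝ V)) t - 1 : Matrix _ _ ℝ)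
      = Matrix.diagonal fun _ => t - 1 := by
    rw [Matrix.scalar_apply, ← Matrix.diagonal_one, Matrix.diagonal_sub]
  rw [e, Matrix.det_diagonal]
  simp

/-- Cayley–Hamilton for the translation, whose difference with the identity is the forward
difference. -/
lemma fwdDiff_iterate_eq_zero [FiniteDimensional ℝ V]
    (hV : ∀ c > 0, ∀ h : ℝ, ∀ v ∈ V, (fun x => v (c * x + h)) ∈ V) (hm : ∀ v ∈ V, Measurable v)
    (h : ℝ) (v : V) : (fwdDiff h)^[Module.finrank ℝ V] (v : ℝ → ℝ) = 0 := by
  have h1 := LinearMap.aeval_self_charpoly (affineComp hV 1 one_pos h)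
  rw [charpoly_translate hV hm] at h1
  simp only [map_pow, map_sub, Polynomial.aeval_X, map_one] at h1
  have h2 : ∀ n : ℕ, (fwdDiff h)^[n] (v : ℝ → ℝ)
      = (((affineComp hV 1 one_pos h - 1) ^ n) v : V) := by
    intro n
    induction n with
    | zero => rfl
    | succ n ih =>
      rw [Function.iterate_succ_apply', ih, pow_succ', Module.End.mul_apply]
      ext x
      simp [fwdDiff]
  rw [h2, h1]
  rfl

lemma continuous_of_mem_invariant [FiniteDimensional ℝ V]
    (hV : ∀ c > 0, ∀ h : ℝ, ∀ v ∈ V, (fun x => v (c * x + h)) ∈ V) (hm : ∀ v ∈ V, Measurable v)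
    (v : V) : Continuous (v : ℝ → ℝ) := by
  classical
  let b := Module.finBasis ℝ V
  refine continuous_iff_continuousAt.2 fun x => ?_
  -- Since `v y` is the translate of `v` by `y - x` evaluated at `x`, continuity of the matrices at
  -- 0 gives continuity of `v` at `x`.
  have hx : (v : ℝ → ℝ) = fun y => ∑ i, (LinearMap.toMatrix b b
      (affineComp hV 1 one_pos (y - x)) *ᵥ b.repr v) i * (b i : ℝ → ℝ) x := by
    ext y
    have h1 : (affineComp hV 1 one_pos (y - x) v : ℝ → ℝ) x = (v : ℝ → ℝ) y := by simp
    rw [← h1, LinearMap.toMatrix_mulVec_repr]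
    have h2 := congrArg (evalFunctional V x) (b.sum_repr (affineComp hV 1 one_pos (y - x) v))
    simpa only [map_sum, map_smul, evalFunctional_apply, smul_eq_mul] using h2.symm
  rw [hx]
  have hM : ContinuousAt (fun y => LinearMap.toMatrix b b (affineComp hV 1 one_pos (y - x))) x := by
    refine ContinuousAt.comp_of_eq (f := fun y => y - x)
      (g := fun h => LinearMap.toMatrix b b (affineComp hV 1 one_pos h))
      (continuousAt_toMatrix_translate hV hm b) (continuous_sub_right x).continuousAt (sub_self x)
  refine tendsto_finsetSum _ fun i _ => Tendsto.mul_const _ ?_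
  have hlin : Continuous fun N : Matrix (Fin (Module.finrank ℝ V)) (Fin (Module.finrank ℝ V)) ℝ =>
      (N *ᵥ b.repr v) i := (continuous_apply i).comp (continuous_id.matrix_mulVec continuous_const)
  exact hlin.continuousAt.comp hM

/-- A finite-dimensional space of measurable functions stable under positive affine changes of
variable consists of polynomials of degree less than its dimension. -/
theorem exists_polynomial_of_mem_invariant [FiniteDimensional ℝ V]
    (hV : ∀ c > 0, ∀ h : ℝ, ∀ v ∈ V, (fun x => v (c * x + h)) ∈ V)
    (hm : ∀ v ∈ V, Measurable v) {v : ℝ → ℝ} (hv : v ∈ V) :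
    ∃ P ∈ Polynomial.degreeLT ℝ (Module.finrank ℝ V), v = fun x => P.eval x :=
  exists_polynomial_of_fwdDiff_iterate_eq_zero (continuous_of_mem_invariant hV hm ⟨v, hv⟩)
    fun h => fwdDiff_iterate_eq_zero hV hm h ⟨v, hv⟩

end Invariant

end RiskRL

namespace RiskRL

/-! ### One-state MDPs and finitely supported return distributions -/

lemma Model.bellman_apply {X A : Type*} [MeasurableSpace X] [MeasurableSpace A]
    (M : Model X A) (γ : Discount) (π : Policy X A) (η : ReturnFunction X) {r : X × A → ℝ}
    (hr : ∀ p, M.reward p = Measure.dirac (r p)) (x : X) {B : Set ℝ} (hB : MeasurableSet B) :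
    (M.bellman γ π η).dist x B = ∫⁻ a, (η.dist ∘ₖ M.transition) (x, a)
      ((fun z => r (x, a) + (γ : ℝ) * z) ⁻¹' B) ∂(π.act x) := by
  have hg : Measurable fun q : A × ℝ × ℝ => q.2.1 + (γ : ℝ) * q.2.2 := by fun_prop
  simp only [Model.bellman]
  rw [Kernel.map_apply' _ hg _ hB, Kernel.compProd_apply (hg hB)]
  refine lintegral_congr fun a => ?_
  rw [Kernel.prod_apply, hr, Measure.dirac_prod, Measure.map_apply (by fun_prop)]
  · rfl
  · exact measurable_prodMk_left (hg hB)

section OneState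

variable {A : Type u} [MeasurableSpace A] [DiscreteMeasurableSpace A]

/-- The one-state model with deterministic rewards `r`. -/
noncomputable def oneStateModel (r : A → ℝ) : Model PUnit.{u + 1} A where
  transition := Kernel.const _ (Measure.dirac PUnit.unit)
  reward := Kernel.deterministic (fun p => r p.2) (by fun_prop)

/-- The policy which draws the action from `Q`. -/
noncomputable def oneStatePolicy (Q : Measure A) [IsProbabilityMeasure Q] :
    Policy PUnit.{u + 1} A where
  act := Kernel.const _ Q

/-- The return function of a one-state MDP with value `ν`. -/
noncomputable def oneStateReturn (ν : ProbabilityMeasure ℝ) : ReturnFunction PUnit.{u + 1} where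
  dist := Kernel.const _ (ν : Measure ℝ)

lemma oneStateModel_deterministicReward (r : A → ℝ) : (oneStateModel r).DeterministicReward :=
  ⟨fun p => r p.2, fun p => by simp [oneStateModel, Kernel.deterministic_apply]⟩

lemma oneState_bellman_apply (r : A → ℝ) (γ : Discount) (Q : Measure A) [IsProbabilityMeasure Q]
    (ν : ProbabilityMeasure ℝ) (x : PUnit.{u + 1}) {B : Set ℝ} (hB : MeasurableSet B) :
    ((oneStateModel r).bellman γ (oneStatePolicy Q) (oneStateReturn ν)).dist x B
      = ∫⁻ a, (ν : Measure ℝ) ((fun z => r a + (γ : ℝ) * z) ⁻¹' B) ∂Q := by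
  rw [Model.bellman_apply _ _ _ _ (r := fun p => r p.2)
    (fun p => by simp [oneStateModel, Kernel.deterministic_apply]) x hB]
  have h : ∀ p, ((oneStateReturn.{u} ν).dist ∘ₖ (oneStateModel r).transition) p
      = (ν : Measure ℝ) := by
    intro p
    simp [oneStateReturn, oneStateModel]
  simp only [h]
  rfl

variable {m : ℕ} {ψ : Sketch m}

/-- The domain contains all the laws of functions on finite probability spaces. -/
lemma Sketch.DomainClosed.map_mem [Finite A] (hdom : Sketch.DomainClosed.{u} ψ)
    (hne : ψ.domain.Nonempty) (Q : Measure A) [IsProbabilityMeasure Q] (r : A → ℝ) :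
    (⟨Q.map r, Measure.isProbabilityMeasure_map (by fun_prop)⟩ : ProbabilityMeasure ℝ)
      ∈ ψ.domain := by
  obtain ⟨ν, hν⟩ := hne
  -- With discount 0 the Bellman operator forgets `ν` and returns the law of the reward.
  have h := hdom PUnit A (oneStateModel r) ⟨0, by simp⟩ (oneStatePolicy Q)
    (oneStateModel_deterministicReward r) (oneStateReturn ν) (fun _ => hν) PUnit.unit
  refine (congrArg (· ∈ ψ.domain) (Subtype.ext ?_)).mpr h
  refine (Measure.ext fun B hB => ?_)
  rw [Measure.map_apply (Measurable.of_discrete (f := r)) hB]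
  refine Eq.trans ?_ (oneState_bellman_apply r ⟨0, by simp⟩ Q ν PUnit.unit hB).symm
  rw [← lintegral_indicator_one (MeasurableSet.of_discrete (s := r ⁻¹' B))]
  refine lintegral_congr fun a => ?_
  by_cases ha : r a ∈ B <;> simp [ha]

/-- On the domain, the statistics of an affine image depend only on the statistics. -/
lemma Sketch.BellmanClosed.val_affine_eq (hψ : Sketch.BellmanClosed.{u} ψ)
    (hdom : Sketch.DomainClosed.{u} ψ) {ν₁ ν₂ : ProbabilityMeasure ℝ} (h₁ : ν₁ ∈ ψ.domain)
    (h₂ : ν₂ ∈ ψ.domain) (h : ψ.val ⟨ν₁, h₁⟩ = ψ.val ⟨ν₂, h₂⟩) (γ : Discount) (r : ℝ) :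
    ∃ k : ∀ ν ∈ ψ.domain, (⟨(ν : Measure ℝ).map (fun z => r + (γ : ℝ) * z),
      Measure.isProbabilityMeasure_map (by fun_prop)⟩ : ProbabilityMeasure ℝ) ∈ ψ.domain,
      ψ.val ⟨_, k ν₁ h₁⟩ = ψ.val ⟨_, k ν₂ h₂⟩ := by
  let M : Model PUnit.{u + 1} PUnit.{u + 1} := oneStateModel fun _ => r
  let π : Policy PUnit.{u + 1} PUnit.{u + 1} := oneStatePolicy (Measure.dirac PUnit.unit)
  have hcl : M.ClosedUnder γ π ψ.domain :=
    hdom _ _ M γ π (oneStateModel_deterministicReward _)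
  have hat : ∀ ν : ProbabilityMeasure ℝ,
      (M.bellman γ π (oneStateReturn ν)).at PUnit.unit
        = ⟨(ν : Measure ℝ).map (fun z => r + (γ : ℝ) * z),
          Measure.isProbabilityMeasure_map (by fun_prop)⟩ := by
    intro ν
    refine Subtype.ext (Measure.ext fun B hB => ?_)
    refine (oneState_bellman_apply (fun _ => r) γ (Measure.dirac PUnit.unit) ν
      PUnit.unit hB).trans ?_
    rw [lintegral_dirac]
    exact (Measure.map_apply (by fun_prop) hB).symm
  obtain ⟨T, hT⟩ := hψ _ _ M γ π hcl
  have hst : ψ.statistic (oneStateReturn.{u} ν₁) (fun _ => h₁)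
      = ψ.statistic (oneStateReturn.{u} ν₂) (fun _ => h₂) := funext fun _ => Subtype.ext h
  have key := (hT (oneStateReturn ν₁) fun _ => h₁).trans
    ((congrArg T hst).trans (hT (oneStateReturn ν₂) fun _ => h₂).symm)
  have key' := congrArg Subtype.val (congrFun key PUnit.unit)
  refine ⟨fun ν hν => hat ν ▸ hcl (oneStateReturn ν) (fun _ => hν) PUnit.unit, ?_⟩
  simpa only [Sketch.statistic, hat] using key'

end OneState

/-! ### Expectation sketches -/

section Expectation

/-- The probability measure with weights `w` on a finite type. -/
noncomputable def weightMeasure {A : Type*} [Fintype A] [MeasurableSpace A] (w : A → ℝ) :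
    Measure A := ∑ a, ENNReal.ofReal (w a) • Measure.dirac a

lemma isProbabilityMeasure_weightMeasure {A : Type*} [Fintype A] [MeasurableSpace A] {w : A → ℝ}
    (h0 : ∀ a, 0 ≤ w a) (h1 : ∑ a, w a = 1) : IsProbabilityMeasure (weightMeasure w) :=
  ⟨by simp [weightMeasure, ← ENNReal.ofReal_sum_of_nonneg fun a _ => h0 a, h1]⟩

lemma integral_weightMeasure {A : Type*} [Fintype A] [MeasurableSpace A]
    [DiscreteMeasurableSpace A] {w : A → ℝ} (h0 : ∀ a, 0 ≤ w a) (g : A → ℝ) :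
    ∫ a, g a ∂(weightMeasure w) = ∑ a, w a * g a := by
  rw [weightMeasure, integral_finsetSum_measure fun a _ => ?_]
  · simp [integral_smul_measure, ENNReal.toReal_ofReal (h0 _)]
  · exact (integrable_dirac (by simp)).smul_measure ENNReal.ofReal_ne_top

variable {m : ℕ} {ψ : Sketch m} {f : Fin m → ℝ → ℝ}

/-- The functions of an expectation sketch together with the constant function. -/
def sketchFamily (f : Fin m → ℝ → ℝ) : Option (Fin m) → ℝ → ℝ := fun o => o.elim 1 f

/-- A finitely supported signed measure of total mass zero is a multiple of a difference of two
probability laws, to which Bellman-closedness applies. -/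
lemma comp_affine_mem_span (hf : ∀ i, Measurable (f i))
    (hψf : ∀ ν : ψ.domain, ∀ i, Integrable (f i) (ν.1 : Measure ℝ) ∧
      ψ.val ν i = ∫ z, f i z ∂(ν.1 : Measure ℝ))
    (hne : ψ.domain.Nonempty) (hdom : Sketch.DomainClosed.{u} ψ)
    (hψ : Sketch.BellmanClosed.{u} ψ) (i : Fin m) (γ : Discount) (r : ℝ) :
    (fun z => f i (r + (γ : ℝ) * z)) ∈ Submodule.span ℝ (Set.range (sketchFamily f)) := by
  -- Functions become functionals on `ℝ →₀ ℝ`, where the common-kernel criterion for membership in a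
  -- finite span is available.
  have hK : Finsupp.linearCombination ℝ (fun z => f i (r + (γ : ℝ) * z)) ∈ Submodule.span ℝ
      (Set.range fun o => Finsupp.linearCombination ℝ (sketchFamily f o)) := by
    refine mem_span_of_iInf_ker_le_ker fun s hs => ?_
    have hs' : ∀ o, ∑ z ∈ s.support, s z * sketchFamily f o z = 0 := fun o => by
      simpa [Finsupp.linearCombination_apply, Finsupp.sum] using (Submodule.mem_iInf _).1 hs o
    suffices ∑ z ∈ s.support, s z * f i (r + (γ : ℝ) * z) = 0 by
      simpa [Finsupp.linearCombination_apply, Finsupp.sum] using this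
    rcases eq_or_ne s 0 with rfl | hs0
    · simp
    let A := ULift.{u} s.support
    let _ : MeasurableSpace A := ⊤
    have : DiscreteMeasurableSpace A := ⟨fun _ => trivial⟩
    let p : A → ℝ := fun a => (ULift.down a : s.support)
    have hp : Measurable p := Measurable.of_discrete
    have hsum : ∀ g : ℝ → ℝ, ∑ a : A, g (p a) = ∑ z ∈ s.support, g z := fun g => by
      rw [← Finset.sum_coe_sort s.support g]
      exact Fintype.sum_equiv Equiv.ulift _ _ fun _ => rfl
    let c := ∑ z ∈ s.support, |s z|
    have hc : 0 < c := Finset.sum_pos (fun z hz => abs_pos.2 (Finsupp.mem_support_iff.1 hz))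
      (Finsupp.support_nonempty_iff.2 hs0)
    have hs1 : ∑ z ∈ s.support, s z = 0 := by simpa [sketchFamily] using hs' none
    -- Two nonnegative weights differing by `s / c`. The constant function in the family gives `∑ s
    -- = 0`, which makes `w₂` sum to 1.
    let w₁ : A → ℝ := fun a => |s (p a)| / c
    let w₂ : A → ℝ := fun a => (|s (p a)| + s (p a)) / c
    have hw₁ : ∀ a, 0 ≤ w₁ a := fun a => div_nonneg (abs_nonneg (s (p a))) hc.le
    have hw₂ : ∀ a, 0 ≤ w₂ a := fun a =>
      div_nonneg (by linarith [neg_abs_le (s (p a))]) hc.le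
    have hone₁ : ∑ a, w₁ a = 1 := by
      rw [hsum fun z => |s z| / c, ← Finset.sum_div, div_self hc.ne']
    have hone₂ : ∑ a, w₂ a = 1 := by
      rw [hsum fun z => (|s z| + s z) / c, ← Finset.sum_div, Finset.sum_add_distrib, hs1,
        add_zero, div_self hc.ne']
    have := isProbabilityMeasure_weightMeasure hw₁ hone₁
    have := isProbabilityMeasure_weightMeasure hw₂ hone₂
    have hdiff : ∀ g : ℝ → ℝ, Measurable g →
        ∫ z, g z ∂((weightMeasure w₂).map p) - ∫ z, g z ∂((weightMeasure w₁).map p)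
          = (∑ z ∈ s.support, s z * g z) / c := by
      intro g hg
      rw [integral_map hp.aemeasurable hg.aestronglyMeasurable,
        integral_map hp.aemeasurable hg.aestronglyMeasurable, integral_weightMeasure hw₂,
        integral_weightMeasure hw₁, ← Finset.sum_sub_distrib, Finset.sum_div,
        ← hsum fun z => s z * g z / c]
      refine Finset.sum_congr rfl fun a _ => ?_
      simp only [w₁, w₂]
      ring
    obtain ⟨k, hk⟩ := hψ.val_affine_eq hdom (hdom.map_mem hne (weightMeasure w₂) p)
      (hdom.map_mem hne (weightMeasure w₁) p) (by
        ext j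
        rw [(hψf _ j).2, (hψf _ j).2]
        refine sub_eq_zero.1 ((hdiff (f j) (hf j)).trans ?_)
        rw [show ∑ z ∈ s.support, s z * f j z = 0 from hs' (some j), zero_div]) γ r
    have hk' := congrFun hk i
    rw [(hψf _ i).2, (hψf _ i).2] at hk'
    simp only [ProbabilityMeasure.coe_mk] at hk'
    rw [integral_map (by fun_prop) (hf i).aestronglyMeasurable,
      integral_map (by fun_prop) (hf i).aestronglyMeasurable] at hk'
    have h3 := hdiff (fun z => f i (r + (γ : ℝ) * z)) ((hf i).comp (by fun_prop))
    rw [sub_eq_zero.2 hk'] at h3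
    rcases div_eq_zero_iff.1 h3.symm with h4 | h4
    · exact h4
    · exact absurd h4 hc.ne'
  obtain ⟨c, hc⟩ := (Submodule.mem_span_range_iff_exists_fun ℝ).1 hK
  refine (Submodule.mem_span_range_iff_exists_fun ℝ).2 ⟨c, funext fun z => ?_⟩
  simpa using LinearMap.congr_fun hc (Finsupp.single z 1)

/-- The functions of a Bellman-closed expectation sketch of size `m` are polynomials of degree
at most `m`. -/
theorem exists_polynomial_of_bellmanClosed (hf : ∀ i, Measurable (f i))
    (hψf : ∀ ν : ψ.domain, ∀ i, Integrable (f i) (ν.1 : Measure ℝ) ∧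
      ψ.val ν i = ∫ z, f i z ∂(ν.1 : Measure ℝ))
    (hne : ψ.domain.Nonempty) (hdom : Sketch.DomainClosed.{u} ψ)
    (hψ : Sketch.BellmanClosed.{u} ψ) (i : Fin m) :
    ∃ P : Polynomial ℝ, P.natDegree ≤ m ∧ f i = fun x => P.eval x := by
  set V := Submodule.span ℝ (Set.range (sketchFamily f)) with hVdef
  have : FiniteDimensional ℝ V := FiniteDimensional.span_of_finite ℝ (Set.finite_range _)
  have hcontract : ∀ γ : Discount, ∀ r : ℝ, ∀ v ∈ V, (fun z => v (r + (γ : ℝ) * z)) ∈ V := by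
    intro γ r v hv
    induction hv using Submodule.span_induction with
    | mem v h =>
      obtain ⟨o, rfl⟩ := h
      cases o with
      | none => exact Submodule.subset_span ⟨none, rfl⟩
      | some j => exact comp_affine_mem_span hf hψf hne hdom hψ j γ r
    | zero => exact V.zero_mem
    | add v w _ _ h1 h2 => exact V.add_mem h1 h2
    | smul a v _ h => exact V.smul_mem a h
  have hexpand : ∀ γ : Discount, 0 < (γ : ℝ) → ∀ r : ℝ, ∀ v ∈ V,
      (fun z => v ((z - r) / (γ : ℝ))) ∈ V := by
    intro γ hγ r v hv
    let F : V →ₗ[ℝ] V :=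
      (LinearMap.funLeft ℝ ℝ (fun z => r + (γ : ℝ) * z)).restrict (hcontract γ r)
    have hF : ∀ w : V, ∀ z, (F w : ℝ → ℝ) z = (w : ℝ → ℝ) (r + (γ : ℝ) * z) := fun _ _ => rfl
    have hinv : ∀ x, r + (γ : ℝ) * ((x - r) / (γ : ℝ)) = x := fun x => by field_simp; ring
    have hinj : Function.Injective F := fun w₁ w₂ h => by
      ext x
      have := congrFun (congrArg Subtype.val h) ((x - r) / (γ : ℝ))
      rwa [hF, hF, hinv] at this
    -- Finite dimension: the injective contraction operator is onto, so its inverse also preserves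
    -- `V`.
    obtain ⟨w, hw⟩ := LinearMap.injective_iff_surjective.1 hinj ⟨v, hv⟩
    convert! w.2 using 1
    ext x
    have := congrFun (congrArg Subtype.val hw) ((x - r) / (γ : ℝ))
    rw [hF, hinv] at this
    exact this.symm
  have haff : ∀ c > 0, ∀ h : ℝ, ∀ v ∈ V, (fun x => v (c * x + h)) ∈ V := by
    intro c hc h v hv
    -- Any `c > 0` is a quotient of two discounts, `c / (c + 1)` by `1 / (c + 1)`.
    let γ : Discount := ⟨1 / (c + 1), by positivity, by rw [div_lt_one] <;> linarith⟩
    let δ : Discount := ⟨c / (c + 1), by positivity, by rw [div_lt_one] <;> linarith⟩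
    have h1 := hexpand γ (show 0 < 1 / (c + 1) by positivity) 0 _ (hcontract δ h v hv)
    convert! h1 using 1
    ext x
    have e : c * x + h = h + c / (c + 1) * ((x - 0) / (1 / (c + 1))) := by field_simp; ring
    rw [e]
  have hmeas : ∀ v ∈ V, Measurable v := by
    intro v hv
    induction hv using Submodule.span_induction with
    | mem v h =>
      obtain ⟨o, rfl⟩ := h
      cases o with
      | none => exact measurable_const
      | some j => exact hf j
    | zero => exact measurable_const
    | add v w _ _ h1 h2 => exact h1.add h2
    | smul a v _ h => exact h.const_smul a
  obtain ⟨P, hP, hfP⟩ := exists_polynomial_of_mem_invariant haff hmeas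
    (Submodule.subset_span ⟨some i, rfl⟩ : sketchFamily f (some i) ∈ V)
  refine ⟨P, ?_, hfP⟩
  have hcard : Module.finrank ℝ V ≤ m + 1 := by
    simpa [hVdef, Set.finrank] using finrank_range_le_card (R := ℝ) (sketchFamily f)
  have hdeg : P.degree < ((m + 1 : ℕ) : WithBot ℕ) :=
    (Polynomial.mem_degreeLT.1 hP).trans_le (by exact_mod_cast hcard)
  exact Polynomial.natDegree_le_iff_degree_le.2 (Order.lt_succ_iff.1 hdeg)

lemma momentSketch_integrable_pow {ν : ProbabilityMeasure ℝ} (hν : ν ∈ (momentSketch m).domain)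
    {j : ℕ} (hj : j ≤ m) : Integrable (fun z : ℝ => z ^ j) (ν : Measure ℝ) := by
  cases j with
  | zero => simp
  | succ j => exact Set.mem_iInter.1 hν ⟨j, hj⟩

lemma integrable_eval_of_mem_momentSketch {ν : ProbabilityMeasure ℝ}
    (hν : ν ∈ (momentSketch m).domain) {P : Polynomial ℝ} (hP : P.natDegree ≤ m) :
    Integrable (fun z => P.eval z) (ν : Measure ℝ) := by
  simp only [Polynomial.eval_eq_sum_range]
  refine integrable_finsetSum _ fun j hj => (momentSketch_integrable_pow hν ?_).const_mul _
  exact (Nat.lt_succ_iff.1 (Finset.mem_range.1 hj)).trans hP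

lemma integral_eval_eq_of_momentSketch_eq {ν₁ ν₂ : ProbabilityMeasure ℝ}
    (h₁ : ν₁ ∈ (momentSketch m).domain) (h₂ : ν₂ ∈ (momentSketch m).domain)
    (h : (momentSketch m).val ⟨ν₁, h₁⟩ = (momentSketch m).val ⟨ν₂, h₂⟩)
    {P : Polynomial ℝ} (hP : P.natDegree ≤ m) :
    ∫ z, P.eval z ∂(ν₁ : Measure ℝ) = ∫ z, P.eval z ∂(ν₂ : Measure ℝ) := by
  have hle : ∀ j ∈ Finset.range (P.natDegree + 1), j ≤ m := fun j hj =>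
    (Nat.lt_succ_iff.1 (Finset.mem_range.1 hj)).trans hP
  simp only [Polynomial.eval_eq_sum_range]
  rw [integral_finsetSum _ fun j hj => (momentSketch_integrable_pow h₁ (hle j hj)).const_mul _,
    integral_finsetSum _ fun j hj => (momentSketch_integrable_pow h₂ (hle j hj)).const_mul _]
  refine Finset.sum_congr rfl fun j hj => ?_
  rw [integral_const_mul, integral_const_mul]
  congr 1
  have hj := hle j hj
  cases j with
  | zero => simp
  | succ j => exact congrFun h ⟨j, hj⟩

end Expectation

end RiskRL

/-! ### From polynomial sketches to planning -/

open RiskRL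
theorem mainTheorem9 {m : ℕ} (ψ : Sketch m) (f : Fin m → ℝ → ℝ)
    (hf : ∀ i, Measurable (f i))
    (hψf : ∀ ν : ψ.domain, ∀ i, Integrable (f i) (ν.1 : Measure ℝ) ∧
      ψ.val ν i = ∫ z, f i z ∂(ν.1 : Measure ℝ))
    (hne : ψ.domain.Nonempty)
    (hdom : Sketch.DomainClosed.{u} ψ)
    (hψ : Sketch.BellmanClosed.{u} ψ)
    (ρ : RiskMeasure)
    (hρ : ∀ ν ∈ ρ.domain, ν ∈ (momentSketch m).domain →
      (∀ i, Integrable (f i) (ν : Measure ℝ)) → ν ∈ ψ.domain) :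
    (RiskMeasure.PlansExactly.{u} ρ ψ → RiskMeasure.PlansExactly.{u} ρ (momentSketch m)) ∧
    ∀ (X A : Type u) [MeasurableSpace X] [MeasurableSpace A] (γ : Discount) (M : Model X A)
      (S : Set (Model X A)),
      ρ.PlansExactlyIn ψ γ M S → ρ.PlansExactlyIn (momentSketch m) γ M S := by
  have hpoly := exists_polynomial_of_bellmanClosed hf hψf hne hdom hψ
  have hmem : ∀ ν ∈ ρ.domain, ν ∈ (momentSketch m).domain → ν ∈ ψ.domain := by
    refine fun ν h hν => hρ ν h hν fun i => ?_
    obtain ⟨P, hP, hfP⟩ := hpoly i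
    rw [hfP]
    exact integrable_eval_of_mem_momentSketch hν hP
  have hall : ∀ (X A : Type u) [MeasurableSpace X] [MeasurableSpace A] (γ : Discount)
      (M : Model X A) (S : Set (Model X A)),
      ρ.PlansExactlyIn ψ γ M S → ρ.PlansExactlyIn (momentSketch m) γ M S := by
    intro X A _ _ γ M S hplan M' hM' h h' π hopt
    obtain ⟨hS, k, k', hval⟩ := hM'
    -- `hmem` needs both memberships: the moments come from equivalence, the domain of `ρ` from the
    -- planning hypotheses.
    have l : M.ReturnsIn γ ψ.domain := fun π x =>
      ⟨(h π x).1, hmem _ (h π x).2 (k π x).2⟩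
    have l' : M'.ReturnsIn γ ψ.domain := fun π x =>
      ⟨(h' π x).1, hmem _ (h' π x).2 (k' π x).2⟩
    refine hplan M' ⟨hS, l, l', fun π x => funext fun i => ?_⟩ h h' π hopt
    obtain ⟨P, hP, hfP⟩ := hpoly i
    rw [(hψf _ i).2, (hψf _ i).2, hfP]
    exact integral_eval_eq_of_momentSketch_eq (k' π x).2 (k π x).2 (hval π x) hP
  exact ⟨fun h X A _ _ γ M S => hall X A γ M S (h X A γ M S), hall⟩
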